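/- Let $G$ and $H$ be finite simple graphs (no loops, no multiple edges). Let $\Delta^{V(H)}$ be the standard simplex with vertex set $V(H)$, and for $S\subseteq V(H)$ let $\Delta^S$ be its face spanned by $S$. The complex $Hom(G,H)$ is the subspace of $\prod_{v\in V(G)}\Delta^{V(H)}$ that is the union of the cells $\prod_{v\in V(G)}\Delta^{\eta(v)}$, over all functions $\eta:V(G)\to 2^{V(H)}\setminus\{\emptyset\}$ such that, for every edge $\overline{uv}$ of $G$, each vertex in $\eta(u)$ is adjacent in $H$ to each vertex in $\eta(v)$. A graph homomorphism $f:G'\to G$ induces the continuous map $\widehat f:Hom(G,H)\to Hom(G',H)$, $(p_v)_{v\in V(G)}\mapsto (p_{f(v)})_{v\in V(G')}$, which maps the cell of $\eta$ into the cell of $\eta\circ f$. Let $x_0,x_1,x_2$ be distinct vertices of $G$ such that $e_1=\overline{x_0x_1}$ and $e_2=\overline{x_1x_2}$ are edges of $G$. Let $G_{x_ix_j}$ be the restriction of $G$ to the edge $\overline{x_ix_j}$ and $\alpha_{ij}:G_{x_ix_j}\to G$ the inclusion. Let $\overrightarrow{e_1e_2}:G_{x_0x_1}\to G_{x_1x_2}$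 be the perspectivity, that is, the graph homomorphism with $x_0\mapsto x_2$ and $x_1\mapsto x_1$, and let $\mathcal P^H(\overrightarrow{e_1e_2}):Hom(G_{x_1x_2},H)\to Hom(G_{x_0x_1},H)$ be the map induced by it (the parallel transport). Then the maps $$\widehat\alpha_{01}\quad\text{and}\quad \mathcal P^H(\overrightarrow{e_1e_2})\circ\widehat\alpha_{12}\;:\;Hom(G,H)\to Hom(G_{x_0x_1},H)$$ are homotopic. -/

import Mathlib

namespace GraphHomComplex

open SimpleGraph

/-- The multi-valued functions `η : V(G) → 2^{V(H)} \ {∅}` that index the cells of `Hom(G, H)`: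
for every edge `uv` of `G`, every vertex of `η u` is adjacent in `H` to every vertex of `η v`. -/
structure IsCell {V W : Type*} (G : SimpleGraph V) (H : SimpleGraph W) (η : V → Set W) :
    Prop where
  nonempty : ∀ v, (η v).Nonempty
  adj : ∀ u v, G.Adj u v → ∀ a ∈ η u, ∀ b ∈ η v, H.Adj a b

/-- The closed cell `∏_v Δ^{η v}`, as a set of points of `∏_v Δ^{V(H)}`, a point of the simplex
`Δ^{V(H)}` being given by its barycentric coordinates. -/
def cell {V W : Type*} [Fintype W] (η : V → Set W) : Set (V → W → ℝ) :=
  {p | ∀ v, p v ∈ stdSimplex ℝ W ∧ ∀ a, a ∉ η v → p v a = 0}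

/-- The underlying set of `Hom(G, H)`: the union of all its closed cells. -/
def carrier {V W : Type*} [Fintype W] (G : SimpleGraph V) (H : SimpleGraph W) :
    Set (V → W → ℝ) :=
  {p | ∃ η : V → Set W, IsCell G H η ∧ p ∈ cell η}

/-- The space `Hom(G, H) ⊆ ∏_v Δ^{V(H)}`. For finite `G` and `H` there are finitely many cells and
all of them are compact, so the subspace topology is the topology of the cell complex. -/
abbrev Space {V W : Type*} [Fintype W] (G : SimpleGraph V) (H : SimpleGraph W) : Type _ :=
  carrier G H

theorem IsCell.comp {V V' W : Type*} {G : SimpleGraph V} {G' : SimpleGraph V'}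
    {H : SimpleGraph W} {η : V' → Set W} (hη : IsCell G' H η) (f : G →g G') :
    IsCell G H (η ∘ f) :=
  ⟨fun v => hη.nonempty (f v), fun u v huv => hη.adj (f u) (f v) (f.map_adj huv)⟩

theorem comp_mem_cell {V V' W : Type*} [Fintype W] {η : V' → Set W} {p : V' → W → ℝ}
    (hp : p ∈ cell η) (f : V → V') : p ∘ f ∈ cell (η ∘ f) :=
  fun v => hp (f v)

/-- The continuous map `Hom(G', H) → Hom(G, H)` associated to a graph homomorphism `f : G → G'`.
It sends the cell of `η` into the cell of `η ∘ f`. -/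
def induced {V V' W : Type*} [Fintype W] {G : SimpleGraph V} {G' : SimpleGraph V'}
    (f : G →g G') (H : SimpleGraph W) : C(Space G' H, Space G H) where
  toFun p := ⟨p.1 ∘ f, by
    obtain ⟨η, hη, hp⟩ := p.2
    exact ⟨η ∘ f, hη.comp f, comp_mem_cell hp f⟩⟩
  continuous_toFun := by
    refine Continuous.subtype_mk (continuous_pi fun v => ?_) _
    exact (continuous_apply (f v)).comp continuous_subtype_val

/-- The restriction `G_{xy}` of `G` to the edge `xy`, as a graph on the vertex set `{x, y}`. -/
abbrev edgeGraph {V : Type*} {G : SimpleGraph V} {x y : V} (h : G.Adj x y) :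
    SimpleGraph (G.subgraphOfAdj h).verts :=
  (G.subgraphOfAdj h).coe

/-- The inclusion map `G_{xy} → G`. -/
abbrev edgeInclusion {V : Type*} {G : SimpleGraph V} {x y : V} (h : G.Adj x y) :
    edgeGraph h →g G :=
  (G.subgraphOfAdj h).hom

open Classical in
/-- The perspectivity from the edge `x₀x₁` to the edge `x₁x₂`: it sends `x₀` to `x₂` and fixes
the common vertex `x₁`. -/
noncomputable def perspectivity {V : Type*} {G : SimpleGraph V} {x₀ x₁ x₂ : V}
    (h₀₁ : G.Adj x₀ x₁) (h₁₂ : G.Adj x₁ x₂) : edgeGraph h₀₁ →g edgeGraph h₁₂ where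
  toFun v := if v.1 = x₀ then ⟨x₂, by simp⟩ else ⟨x₁, by simp⟩
  map_rel' := by
    rintro ⟨a, ha⟩ ⟨b, hb⟩ hab
    have h := h₀₁.ne
    simp only [Subgraph.coe_adj, subgraphOfAdj_adj, Sym2.eq_iff] at hab
    rcases hab with ⟨rfl, rfl⟩ | ⟨rfl, rfl⟩ <;> simp [h.symm]

theorem perspectivity_fst {V : Type*} {G : SimpleGraph V} {x₀ x₁ x₂ : V}
    (h₀₁ : G.Adj x₀ x₁) (h₁₂ : G.Adj x₁ x₂) :
    perspectivity h₀₁ h₁₂ ⟨x₀, by simp⟩ = ⟨x₂, by simp⟩ :=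
  if_pos rfl

theorem perspectivity_snd {V : Type*} {G : SimpleGraph V} {x₀ x₁ x₂ : V}
    (h₀₁ : G.Adj x₀ x₁) (h₁₂ : G.Adj x₁ x₂) :
    perspectivity h₀₁ h₁₂ ⟨x₁, by simp⟩ = ⟨x₁, by simp⟩ :=
  if_neg h₀₁.ne'

/-- The parallel transport `P^H : Hom(G_{x₁x₂}, H) → Hom(G_{x₀x₁}, H)` along the perspectivity
from `x₀x₁` to `x₁x₂`. It sends the cell of `η` to the cell of `η'` with `η' x₀ = η x₂` and
`η' x₁ = η x₁`. -/
noncomputable def transport {V W : Type*} [Fintype W] {G : SimpleGraph V} {x₀ x₁ x₂ : V}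
    (h₀₁ : G.Adj x₀ x₁) (h₁₂ : G.Adj x₁ x₂) (H : SimpleGraph W) :
    C(Space (edgeGraph h₁₂) H, Space (edgeGraph h₀₁) H) :=
  induced (perspectivity h₀₁ h₁₂) H

end GraphHomComplex

namespace GraphHomComplex

open SimpleGraph

/-! By functoriality the second map is induced by the homomorphism `x₀ ↦ x₂`, `x₁ ↦ x₁` from the
edge into `G`. Together with the inclusion it satisfies the mixed condition `hfg` of
`induced_homotopic`. For such `f`, `g` and any cell `η`, the pointwise union of `η ∘ f` and `η ∘ g`
again indexes a cell (`IsCell.union`). That cell is a product of simplices, hence convex, so it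
contains the segment from `p ∘ f` to `p ∘ g`, and the straight-line homotopy never leaves the
complex. -/

theorem IsCell.union {V V' W : Type*} {G : SimpleGraph V} {G' : SimpleGraph V'}
    {H : SimpleGraph W} {η : V' → Set W} (hη : IsCell G' H η) (f g : G →g G')
    (hfg : ∀ u v, G.Adj u v → G'.Adj (f u) (g v)) :
    IsCell G H (fun v => η (f v) ∪ η (g v)) where
  nonempty v := (hη.nonempty (f v)).inl
  adj u v huv a ha b hb := by
    rcases ha with ha | ha <;> rcases hb with hb | hb
    · exact hη.adj _ _ (f.map_adj huv) a ha b hb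
    · exact hη.adj _ _ (hfg u v huv) a ha b hb
    -- Applying `hfg` to the reversed edge gives the other mixed adjacency, so the one-sided
    -- hypothesis suffices.
    · exact hη.adj _ _ (hfg v u huv.symm).symm a ha b hb
    · exact hη.adj _ _ (g.map_adj huv) a ha b hb

theorem lineMap_mem_cell {V V' W : Type*} [Fintype W] {η : V' → Set W} {p : V' → W → ℝ}
    (hp : p ∈ cell η) (f g : V → V') {t : ℝ} (ht₀ : 0 ≤ t) (ht₁ : t ≤ 1) :
    (fun v => (1 - t) • p (f v) + t • p (g v)) ∈ cell (fun v => η (f v) ∪ η (g v)) := by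
  intro v
  refine ⟨convex_stdSimplex ℝ W (hp (f v)).1 (hp (g v)).1 (sub_nonneg.2 ht₁) ht₀
    (sub_add_cancel 1 t), fun a ha => ?_⟩
  rw [Set.mem_union, not_or] at ha
  simp [(hp (f v)).2 a ha.1, (hp (g v)).2 a ha.2]

/-- Two graph homomorphisms that send the two ends of each edge to adjacent vertices, in whichever
way one of them is applied at each end, induce homotopic maps, by the straight-line homotopy. -/
theorem induced_homotopic {V V' W : Type*} [Fintype W] {G : SimpleGraph V} {G' : SimpleGraph V'}
    (H : SimpleGraph W) (f g : G →g G') (hfg : ∀ u v, G.Adj u v → G'.Adj (f u) (g v)) :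
    ContinuousMap.Homotopic (induced f H) (induced g H) := by
  refine ⟨⟨⟨fun q => ⟨fun v => (1 - (q.1 : ℝ)) • q.2.1 (f v) + (q.1 : ℝ) • q.2.1 (g v), ?_⟩, ?_⟩,
    fun p => ?_, fun p => ?_⟩⟩
  · obtain ⟨η, hη, hp⟩ := q.2.2
    exact ⟨_, hη.union f g hfg, lineMap_mem_cell hp f g q.1.2.1 q.1.2.2⟩
  · have hcoord : ∀ w : V', Continuous fun q : unitInterval × Space G' H => q.2.1 w := fun w =>
      (continuous_apply w).comp (continuous_subtype_val.comp continuous_snd)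
    have ht : Continuous fun q : unitInterval × Space G' H => (q.1 : ℝ) :=
      continuous_subtype_val.comp continuous_fst
    exact Continuous.subtype_mk (continuous_pi fun v =>
      ((continuous_const.sub ht).smul (hcoord (f v))).add (ht.smul (hcoord (g v)))) _
  · apply Subtype.ext
    funext v
    simp [induced]
  · apply Subtype.ext
    funext v
    simp [induced]

/-- Contravariant functoriality: both sides precompose a point with the same map of vertices. -/
theorem transport_comp_induced {V W : Type*} [Fintype W] {G : SimpleGraph V} {x₀ x₁ x₂ : V}
    (h₀₁ : G.Adj x₀ x₁) (h₁₂ : G.Adj x₁ x₂) (H : SimpleGraph W) :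
    (transport h₀₁ h₁₂ H).comp (induced (edgeInclusion h₁₂) H) =
      induced ((edgeInclusion h₁₂).comp (perspectivity h₀₁ h₁₂)) H :=
  rfl

theorem adj_edgeInclusion_perspectivity {V : Type*} {G : SimpleGraph V} {x₀ x₁ x₂ : V}
    (h₀₁ : G.Adj x₀ x₁) (h₁₂ : G.Adj x₁ x₂) (u v : (G.subgraphOfAdj h₀₁).verts)
    (huv : (edgeGraph h₀₁).Adj u v) :
    G.Adj (edgeInclusion h₀₁ u) (edgeInclusion h₁₂ (perspectivity h₀₁ h₁₂ v)) := by
  obtain ⟨u, hu⟩ := u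
  obtain ⟨v, hv⟩ := v
  simp only [Subgraph.coe_adj, subgraphOfAdj_adj, Sym2.eq_iff] at huv
  -- The two orientations of the edge yield the pairs `x₀, x₁` and `x₁, x₂`, which are exactly the
  -- two given edges.
  rcases huv with ⟨rfl, rfl⟩ | ⟨rfl, rfl⟩
  · rw [perspectivity_snd]
    exact h₀₁
  · rw [perspectivity_fst]
    exact h₁₂

end GraphHomComplex

theorem proposition3p3 {V W : Type*} [Fintype V] [Fintype W]
    (G : SimpleGraph V) (H : SimpleGraph W) (x₀ x₁ x₂ : V) (_h₀₂ : x₀ ≠ x₂)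
    (h₀₁ : G.Adj x₀ x₁) (h₁₂ : G.Adj x₁ x₂) :
    ContinuousMap.Homotopic
      (GraphHomComplex.induced (GraphHomComplex.edgeInclusion h₀₁) H)
      ((GraphHomComplex.transport h₀₁ h₁₂ H).comp
        (GraphHomComplex.induced (GraphHomComplex.edgeInclusion h₁₂) H)) := by
  rw [GraphHomComplex.transport_comp_induced]
  exact GraphHomComplex.induced_homotopic H _ _
    (GraphHomComplex.adj_edgeInclusion_perspectivity h₀₁ h₁₂)
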